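/- For real $\mu>-1$ and $x>0$ let $$I_\mu(x)=\sum_{k=0}^\infty \frac{(x/2)^{2k+\mu}}{k!\,\Gamma(\mu+k+1)}$$ be the modified Bessel function of the first kind. For $\nu>0$, $a>0$ and $t>0$ let $$f_{\nu,a}(t)=\frac{t^\nu}{a^{\nu-1}}\exp\left(-\frac{t^2+a^2}{2}\right)I_{\nu-1}(at)$$ be the integrand of the generalized Marcum $Q$ function $Q_\nu(a,b)=\int_b^\infty f_{\nu,a}(t)\,dt$, and let $$f_{\nu,0}(t)=\lim_{a\downarrow 0}f_{\nu,a}(t)=\frac{t^{2\nu-1}e^{-t^2/2}}{2^{\nu-1}\Gamma(\nu)}.$$ **Theorem.** The equation $$\frac{I_\nu(\sqrt{5-2\nu})}{I_{\nu-1}(\sqrt{5-2\nu})}=\frac{3-2\nu}{\sqrt{5-2\nu}}$$ has exactly one solution $\nu_0$ in the interval $\nu\in(1/2,3/2)$. This solution satisfies $\nu_0\approx 0.78449776$, correctly rounded, i.e. $|\nu_0-0.78449776|\le 5\cdot 10^{-9}$. Moreover, for every $\nu>0$, the function $f_{\nu,a}$ is log-concave on $(0,\infty)$ for all $a\ge 0$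 if and only if $\nu\ge\nu_0$. -/

import Mathlib

/-- The modified Bessel function of the first kind of real order `ν`, at a real argument `t ≥ 0`:
`I_ν(t) = ∑ₖ (t/2)^(2k+ν) / (k! Γ(ν+k+1))`. -/
noncomputable def besselI (ν t : ℝ) : ℝ :=
  ∑' k : ℕ, (t / 2) ^ (2 * (k : ℝ) + ν) / ((k.factorial : ℝ) * Real.Gamma (ν + k + 1))

/-- The integrand of the generalized Marcum Q function
`Q_ν(a,b) = ∫_b^∞ (t^ν / a^(ν-1)) exp(-(t²+a²)/2) I_{ν-1}(a t) dt`, for `ν > 0`, `a ≥ 0`, `t > 0`.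
At `a = 0` the value is the limit as `a ↓ 0`; see `marcumIntegrand_tendsto`. -/
noncomputable def marcumIntegrand (ν a t : ℝ) : ℝ :=
  if a = 0 then
    t ^ (2 * ν - 1) * Real.exp (-(t ^ 2) / 2) / (2 ^ (ν - 1) * Real.Gamma ν)
  else
    t ^ ν / a ^ (ν - 1) * Real.exp (-((t ^ 2 + a ^ 2) / 2)) * besselI (ν - 1) (a * t)

/-- A nonnegative function `f` is log-concave on the convex set `s`. -/
def LogConcaveOn (s : Set ℝ) (f : ℝ → ℝ) : Prop :=
  Convex ℝ s ∧ (∀ x ∈ s, 0 ≤ f x) ∧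
    ∀ x ∈ s, ∀ y ∈ s, ∀ p q : ℝ, 0 < p → 0 < q → p + q = 1 →
      f x ^ p * f y ^ q ≤ f (p * x + q * y)

/-- The series in the Bessel function with its leading power removed converges. -/
theorem besselI_summable {ν : ℝ} (hν : 0 < ν) {z : ℝ} (hz : 0 < z) :
    Summable (fun k : ℕ => z ^ (2 * k) / ((k.factorial : ℝ) * Real.Gamma (ν + k))) := by
  have hG : ∀ k : ℕ, 0 < Real.Gamma (ν + k) := fun k => Real.Gamma_pos_of_pos (by positivity)
  refine summable_of_ratio_test_tendsto_lt_one (l := 0) zero_lt_one ?_ ?_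
  · refine Filter.Eventually.of_forall fun k => ?_
    have := hG k
    positivity
  · have hlim : Filter.Tendsto (fun k : ℕ => z ^ 2 / ν * (1 / ((k : ℝ) + 1)))
        Filter.atTop (nhds 0) := by
      simpa using tendsto_one_div_add_atTop_nhds_zero_nat.const_mul (z ^ 2 / ν)
    refine squeeze_zero (fun k => by positivity) (fun k => ?_) hlim
    have h1 := hG k
    have h2 : Real.Gamma (ν + (k + 1 : ℕ)) = (ν + k) * Real.Gamma (ν + k) := by
      rw [← Real.Gamma_add_one (by positivity)]
      push_cast
      ring_nf
    have h3 : ‖z ^ (2 * (k + 1)) / (((k + 1).factorial : ℝ) * Real.Gamma (ν + (k + 1 : ℕ)))‖ /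
        ‖z ^ (2 * k) / ((k.factorial : ℝ) * Real.Gamma (ν + k))‖
        = z ^ 2 / (ν + k) * (1 / ((k : ℝ) + 1)) := by
      rw [h2, Nat.factorial_succ, Real.norm_of_nonneg (by positivity),
        Real.norm_of_nonneg (by positivity)]
      push_cast
      have : (k.factorial : ℝ) ≠ 0 := by positivity
      field_simp
      ring
    rw [h3]
    gcongr
    linarith [(Nat.cast_nonneg k : (0 : ℝ) ≤ k)]

/-- The integrand with the powers of `a` cancelled. -/
theorem marcumIntegrand_of_pos {ν a t : ℝ} (ha : 0 < a) (ht : 0 < t) :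
    marcumIntegrand ν a t = t ^ ν * (t / 2) ^ (ν - 1) * Real.exp (-((t ^ 2 + a ^ 2) / 2)) *
      ∑' k : ℕ, (a * t / 2) ^ (2 * k) / ((k.factorial : ℝ) * Real.Gamma (ν + k)) := by
  have h : besselI (ν - 1) (a * t) = a ^ (ν - 1) * (t / 2) ^ (ν - 1) *
      ∑' k : ℕ, (a * t / 2) ^ (2 * k) / ((k.factorial : ℝ) * Real.Gamma (ν + k)) := by
    rw [besselI, ← tsum_mul_left]
    refine tsum_congr fun k => ?_
    have hz : 0 < a * t / 2 := by positivity
    rw [Real.rpow_add hz, ← Real.mul_rpow ha.le (by positivity), mul_div_assoc a t 2]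
    have h2 : (a * (t / 2)) ^ (2 * (k : ℝ)) = (a * (t / 2)) ^ (2 * k) := by
      rw [← Real.rpow_natCast]
      push_cast
      rfl
    rw [h2, show ν - 1 + k + 1 = ν + k by ring]
    ring
  have ha' : a ^ (ν - 1) ≠ 0 := (Real.rpow_pos_of_pos ha _).ne'
  rw [marcumIntegrand, if_neg ha.ne', h]
  field_simp

/-- The value of the integrand at `a = 0` is its limit as `a ↓ 0`. -/
theorem marcumIntegrand_tendsto {ν t : ℝ} (hν : 0 < ν) (ht : 0 < t) :
    Filter.Tendsto (fun a => marcumIntegrand ν a t) (nhdsWithin 0 (Set.Ioi 0))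
      (nhds (marcumIntegrand ν 0 t)) := by
  have hS : Filter.Tendsto
      (fun a : ℝ => ∑' k : ℕ, (a * t / 2) ^ (2 * k) / ((k.factorial : ℝ) * Real.Gamma (ν + k)))
      (nhdsWithin 0 (Set.Ioi 0))
      (nhds (∑' k : ℕ, ((0 : ℝ) * t / 2) ^ (2 * k) /
        ((k.factorial : ℝ) * Real.Gamma (ν + k)))) := by
    refine tendsto_tsum_of_dominated_convergence
      (besselI_summable hν (show 0 < t / 2 by positivity)) (fun k => ?_) ?_
    · refine Filter.Tendsto.mono_left ?_ nhdsWithin_le_nhds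
      exact Continuous.tendsto (by fun_prop)
        (0 : ℝ)
    · filter_upwards [Ioc_mem_nhdsGT (zero_lt_one' ℝ)] with a ha k
      have h1 : 0 < Real.Gamma (ν + k) := Real.Gamma_pos_of_pos (by positivity)
      have ha0 : 0 < a := ha.1
      rw [Real.norm_of_nonneg (by positivity)]
      gcongr
      nlinarith [ha.2]
  have h0 : ∑' k : ℕ, ((0 : ℝ) * t / 2) ^ (2 * k) / ((k.factorial : ℝ) * Real.Gamma (ν + k))
      = 1 / Real.Gamma ν := by
    rw [tsum_eq_single 0]
    · simp
    · intro k hk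
      simp [hk]
  rw [h0] at hS
  have hE : Filter.Tendsto
      (fun a : ℝ => t ^ ν * (t / 2) ^ (ν - 1) * Real.exp (-((t ^ 2 + a ^ 2) / 2)))
      (nhdsWithin 0 (Set.Ioi 0))
      (nhds (t ^ ν * (t / 2) ^ (ν - 1) * Real.exp (-((t ^ 2 + (0 : ℝ) ^ 2) / 2)))) :=
    (Continuous.tendsto (by fun_prop) (0 : ℝ)).mono_left nhdsWithin_le_nhds
  have hval : marcumIntegrand ν 0 t =
      t ^ ν * (t / 2) ^ (ν - 1) * Real.exp (-((t ^ 2 + (0 : ℝ) ^ 2) / 2)) *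
        (1 / Real.Gamma ν) := by
    have h2 : t ^ (2 * ν - 1) = t ^ ν * t ^ (ν - 1) := by
      rw [← Real.rpow_add ht]
      ring_nf
    rw [marcumIntegrand, if_pos rfl, h2, Real.div_rpow ht.le (by norm_num)]
    have h3 : -(t ^ 2) / 2 = -((t ^ 2 + (0 : ℝ) ^ 2) / 2) := by ring
    rw [h3]
    have := (Real.rpow_pos_of_pos (zero_lt_two' ℝ) (ν - 1)).ne'
    have := (Real.Gamma_pos_of_pos hν).ne'
    field_simp
  rw [hval]
  refine (hE.mul hS).congr' ?_
  filter_upwards [self_mem_nhdsWithin] with a ha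
  exact (marcumIntegrand_of_pos ha ht).symm

/-! Write $S_\nu$ for `besselSeries`, so that $S_\nu'=S_{\nu+1}$. Up to a constant factor the
integrand is $e^{-t^2/2}$ times $u^{2\nu-1}S_\nu(u^2/4)$ at $u=at$. Rescaling $t$ by $1/a$ and
letting $a\to\infty$ flattens the Gaussian, so log-concavity for every $a$ amounts to concavity of
`logKernel`, that is, to $N\ge 0$ on $(0,\infty)$ for $N$ = `concavityForm ν`.

The derivative of $y^{\nu-3/2}N(y)$ is a positive multiple of $E$ = `criticalForm ν` when $\nu>1/2$,
and $E$ is then increasing. For $1/2<\nu<3/2$, $E(0)<0$, so a zero $c$ of $E$ is the minimum point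
of the weighted form, where $N(c)=S_\nu(c)^2(5-2\nu-4c)$. Hence $N\ge 0$ exactly when $E\ge 0$ at
$y=(5-2\nu)/4$, and equality there is the Bessel equation with $z^2=4y=5-2\nu$. For $\nu\le 1/2$ an
explicit point gives $N<0$; for $\nu\ge 3/2$ the weighted form is monotone and $N(0)>0$.

It remains to study the sign of $E$ at that point as $\nu$ varies. The continued fraction of Bessel
ratios, unrolled twice, turns it into the sign of `defect`: a rational function plus a tail with
Lipschitz constant 1. The defect has one sign change, located by truncating the continued fraction.
-/

/-! ### The entire series and its recurrence -/

/-- The entire part of the modified Bessel function: `I_{ν-1}(z) = (z/2)^(ν-1) S_ν(z²/4)`. -/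
noncomputable def besselSeries (ν y : ℝ) : ℝ :=
  ∑' k : ℕ, y ^ k / ((k.factorial : ℝ) * Real.Gamma (ν + k))

theorem summable_besselSeries {ν : ℝ} (hν : 0 < ν) (y : ℝ) :
    Summable (fun k : ℕ => y ^ k / ((k.factorial : ℝ) * Real.Gamma (ν + k))) := by
  have hz : 0 < Real.sqrt (|y| + 1) := Real.sqrt_pos.2 (by positivity)
  refine Summable.of_norm_bounded (besselI_summable hν hz) fun k => ?_
  have hG : 0 < Real.Gamma (ν + k) := Real.Gamma_pos_of_pos (by positivity)
  rw [pow_mul, Real.sq_sqrt (by positivity), norm_div, norm_pow, Real.norm_eq_abs,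
    Real.norm_of_nonneg (by positivity : 0 ≤ (k.factorial : ℝ) * Real.Gamma (ν + k))]
  gcongr
  linarith

theorem besselSeries_deriv_term (ν y : ℝ) (k : ℕ) :
    ((k + 1 : ℕ) : ℝ) * y ^ k / (((k + 1).factorial : ℝ) * Real.Gamma (ν + (k + 1 : ℕ))) =
      y ^ k / ((k.factorial : ℝ) * Real.Gamma (ν + 1 + k)) := by
  rw [Nat.factorial_succ, show ν + ((k + 1 : ℕ) : ℝ) = ν + 1 + k by push_cast; ring, Nat.cast_mul,
    mul_assoc, mul_div_mul_left _ _ (by positivity)]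

theorem hasDerivAt_besselSeries {ν : ℝ} (hν : 0 < ν) (y : ℝ) :
    HasDerivAt (besselSeries ν) (besselSeries (ν + 1) y) y := by
  -- On this interval the differentiated terms are dominated by their values at $|y|+1$.
  have hy : y ∈ Set.Ioo (-(|y| + 1)) (|y| + 1) :=
    ⟨by linarith [neg_abs_le y], by linarith [le_abs_self y]⟩
  have hsum (x : ℝ) : Summable fun k : ℕ =>
      (k : ℝ) * x ^ (k - 1) / ((k.factorial : ℝ) * Real.Gamma (ν + k)) := by
    rw [← summable_nat_add_iff 1]
    refine (summable_besselSeries (by linarith : 0 < ν + 1) x).congr fun k => ?_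
    rw [Nat.add_sub_cancel, besselSeries_deriv_term]
  have h := hasDerivAt_tsum_of_isPreconnected (t := Set.Ioo (-(|y| + 1)) (|y| + 1))
    (g := fun (k : ℕ) x => x ^ k / ((k.factorial : ℝ) * Real.Gamma (ν + k)))
    (g' := fun (k : ℕ) x => (k : ℝ) * x ^ (k - 1) / ((k.factorial : ℝ) * Real.Gamma (ν + k)))
    (hsum (|y| + 1)) isOpen_Ioo isPreconnected_Ioo
    (fun k x _ => (hasDerivAt_pow k x).div_const _)
    (fun k x hx => by
      have hG : 0 < Real.Gamma (ν + k) := Real.Gamma_pos_of_pos (by positivity)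
      have hx' : |x| ≤ |y| + 1 := abs_le.2 ⟨hx.1.le, hx.2.le⟩
      rw [norm_div, norm_mul, norm_pow, Real.norm_eq_abs x,
        Real.norm_of_nonneg (by positivity : 0 ≤ (k.factorial : ℝ) * Real.Gamma (ν + k)),
        Real.norm_of_nonneg (Nat.cast_nonneg k)]
      gcongr)
    hy (summable_besselSeries hν y) hy
  refine h.congr_deriv ?_
  rw [(hsum y).tsum_eq_zero_add, besselSeries]
  simp only [Nat.add_sub_cancel, besselSeries_deriv_term]
  simp

theorem besselSeries_pos {ν y : ℝ} (hν : 0 < ν) (hy : 0 ≤ y) : 0 < besselSeries ν y := by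
  have hG (k : ℕ) : 0 < Real.Gamma (ν + k) := Real.Gamma_pos_of_pos (by positivity)
  refine (summable_besselSeries hν y).tsum_pos (fun k => ?_) 0 ?_
  · have := hG k
    positivity
  · have := hG 0
    simpa using this

theorem besselSeries_recurrence {ν : ℝ} (hν : 0 < ν) (y : ℝ) :
    besselSeries ν y = ν * besselSeries (ν + 1) y + y * besselSeries (ν + 1 + 1) y := by
  have h1 := summable_besselSeries (by linarith : 0 < ν + 1) y
  have h2 := summable_besselSeries (by linarith : 0 < ν + 1 + 1) y
  have e0 := (summable_besselSeries hν y).tsum_eq_zero_add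
  have e1 := h1.tsum_eq_zero_add
  simp only [besselSeries]
  rw [e0, e1, mul_add, add_assoc, ← tsum_mul_left, ← tsum_mul_left,
    ← (((summable_nat_add_iff 1).2 h1).mul_left ν).tsum_add (h2.mul_left y)]
  congr 1
  · have := (Real.Gamma_pos_of_pos hν).ne'
    simp [Real.Gamma_add_one hν.ne']
    field_simp
  · refine tsum_congr fun k => ?_
    have hG := (Real.Gamma_pos_of_pos (by positivity : 0 < ν + 1 + k)).ne'
    have hn : ν + 1 + k ≠ 0 := by positivity
    have hf : (k.factorial : ℝ) ≠ 0 := by positivity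
    have hk : (k : ℝ) + 1 ≠ 0 := by positivity
    rw [show ν + ((k + 1 : ℕ) : ℝ) = ν + 1 + k by push_cast; ring,
      show ν + 1 + ((k + 1 : ℕ) : ℝ) = ν + 1 + k + 1 by push_cast; ring,
      show ν + 1 + 1 + (k : ℝ) = ν + 1 + k + 1 by ring, Real.Gamma_add_one hn, Nat.factorial_succ]
    push_cast
    field_simp
    ring

theorem besselI_eq_rpow_mul_besselSeries (ν : ℝ) {z : ℝ} (hz : 0 < z) :
    besselI ν z = (z / 2) ^ ν * besselSeries (ν + 1) ((z / 2) ^ 2) := by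
  rw [besselI, besselSeries, ← tsum_mul_left]
  refine tsum_congr fun k => ?_
  rw [add_comm (2 * (k : ℝ)), Real.rpow_add (by positivity),
    show 2 * (k : ℝ) = ((2 * k : ℕ) : ℝ) by push_cast; rfl, Real.rpow_natCast, pow_mul,
    add_right_comm ν 1]
  ring

/-- `z I_ν(z) / I_{ν-1}(z)` in the variable `y = z²/4`. -/
noncomputable def besselRatio (ν y : ℝ) : ℝ :=
  2 * y * besselSeries (ν + 1) y / besselSeries ν y

theorem besselRatio_pos {ν y : ℝ} (hν : 0 < ν) (hy : 0 < y) : 0 < besselRatio ν y := by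
  have h0 := besselSeries_pos hν hy.le
  have h1 := besselSeries_pos (by linarith : 0 < ν + 1) hy.le
  unfold besselRatio
  positivity

/-- The three-term recurrence divided by $S_{\nu+1}$: one step of the continued fraction for the
Bessel ratio. -/
theorem besselRatio_recurrence {ν y : ℝ} (hν : 0 < ν) (hy : 0 ≤ y) :
    besselRatio ν y * (2 * ν + besselRatio (ν + 1) y) = 4 * y := by
  have h0 := (besselSeries_pos hν hy).ne'
  have h1 := (besselSeries_pos (by linarith : 0 < ν + 1) hy).ne'
  unfold besselRatio
  field_simp
  linear_combination (-4 * y) * besselSeries_recurrence hν y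

/-! ### Sign of the concavity form -/

/-- The quadratic form in `(S_ν, S_{ν+1})` whose sign is opposite to that of the second
derivative of `log (u ^ (2ν-1) S_ν(u²/4))` at `y = u²/4`. -/
noncomputable def concavityForm (ν y : ℝ) : ℝ :=
  4 * y ^ 2 * besselSeries (ν + 1) y ^ 2 + (2 * ν - 1) *
    (2 * y * besselSeries (ν + 1) y * besselSeries ν y + besselSeries ν y ^ 2) -
    4 * y * besselSeries ν y ^ 2

/-- The linear form in `(S_ν, S_{ν+1})` whose sign is that of the derivative of
`y ^ (ν - 3/2)` times the quadratic form `concavityForm ν y`. -/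
noncomputable def criticalForm (ν y : ℝ) : ℝ :=
  2 * y * besselSeries (ν + 1) y + (2 * ν - 3) * besselSeries ν y

theorem hasDerivAt_concavityForm {ν : ℝ} (hν : 0 < ν) (y : ℝ) :
    HasDerivAt (concavityForm ν)
      (8 * y * besselSeries (ν + 1) y ^ 2 +
        8 * y ^ 2 * besselSeries (ν + 1) y * besselSeries (ν + 1 + 1) y +
        (2 * ν - 1) * (2 * besselSeries (ν + 1) y * besselSeries ν y +
          2 * y * besselSeries (ν + 1 + 1) y * besselSeries ν y +
          2 * y * besselSeries (ν + 1) y ^ 2 +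
          2 * besselSeries ν y * besselSeries (ν + 1) y) -
        4 * besselSeries ν y ^ 2 - 8 * y * besselSeries ν y * besselSeries (ν + 1) y) y := by
  have h0 := hasDerivAt_besselSeries hν y
  have h1 := hasDerivAt_besselSeries (by linarith : 0 < ν + 1) y
  have hid := hasDerivAt_id' y
  refine HasDerivAt.congr_deriv ((((hid.pow 2).const_mul 4).mul (h1.pow 2)).add
    ((((hid.const_mul 2).mul h1).mul h0).add (h0.pow 2) |>.const_mul (2 * ν - 1)) |>.sub
    ((hid.const_mul 4).mul (h0.pow 2))) ?_
  simp
  ring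

theorem strictMonoOn_criticalForm {ν : ℝ} (hν : 1 / 2 < ν) :
    StrictMonoOn (criticalForm ν) (Set.Ici 0) := by
  have hd (y : ℝ) : HasDerivAt (criticalForm ν)
      ((2 * ν - 1) * besselSeries (ν + 1) y + 2 * y * besselSeries (ν + 1 + 1) y) y := by
    have h0 := hasDerivAt_besselSeries (by linarith : 0 < ν) y
    have h1 := hasDerivAt_besselSeries (by linarith : 0 < ν + 1) y
    refine HasDerivAt.congr_deriv
      ((((hasDerivAt_id' y).const_mul 2).mul h1).add (h0.const_mul (2 * ν - 3))) ?_
    ring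
  refine strictMonoOn_of_deriv_pos (convex_Ici 0)
    (fun y _ => (hd y).continuousAt.continuousWithinAt) fun y hy => ?_
  rw [interior_Ici, Set.mem_Ioi] at hy
  have h1 := besselSeries_pos (by linarith : 0 < ν + 1) hy.le
  have h2 := besselSeries_pos (by linarith : 0 < ν + 1 + 1) hy.le
  have : 0 < 2 * ν - 1 := by linarith
  rw [(hd y).deriv]
  positivity

theorem continuous_criticalForm {ν : ℝ} (hν : 0 < ν) : Continuous (criticalForm ν) := by
  have h0 : Continuous (besselSeries ν) :=
    continuous_iff_continuousAt.2 fun y => (hasDerivAt_besselSeries hν y).continuousAt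
  have h1 : Continuous (besselSeries (ν + 1)) := continuous_iff_continuousAt.2 fun y =>
    (hasDerivAt_besselSeries (by linarith : 0 < ν + 1) y).continuousAt
  unfold criticalForm
  fun_prop

/-- The weight $y^{\nu-3/2}$ is chosen so that, once $S_{\nu+2}$ is eliminated, the derivative
factors and only the linear form $E$ can change sign. -/
theorem hasDerivAt_rpow_mul_concavityForm {ν y : ℝ} (hν : 0 < ν) (hy : 0 < y) :
    HasDerivAt (fun x => x ^ (ν - 3 / 2) * concavityForm ν x)
      ((2 * ν - 1) / 2 * y ^ (ν - 3 / 2 - 1) * besselSeries ν y * criticalForm ν y) y := by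
  refine HasDerivAt.congr_deriv ((Real.hasDerivAt_rpow_const (p := ν - 3 / 2)
    (Or.inl hy.ne')).mul (hasDerivAt_concavityForm hν y)) ?_
  have hp : y ^ (ν - 3 / 2) = y ^ (ν - 3 / 2 - 1) * y := by
    rw [← Real.rpow_add_one hy.ne']
    ring_nf
  rw [hp]
  have hr : y * besselSeries (ν + 1 + 1) y = besselSeries ν y - ν * besselSeries (ν + 1) y := by
    linarith [besselSeries_recurrence hν y]
  unfold concavityForm criticalForm
  linear_combination (y ^ (ν - 3 / 2 - 1)) * (8 * y ^ 2 * besselSeries (ν + 1) y +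
    (2 * ν - 1) * 2 * y * besselSeries ν y) * hr

theorem concavityForm_nonneg_of_three_halves_le {ν : ℝ} (hν : 3 / 2 ≤ ν) {y : ℝ} (hy : 0 < y) :
    0 ≤ concavityForm ν y := by
  have hν0 : 0 < ν := by linarith
  have hmono : MonotoneOn (fun x => x ^ (ν - 3 / 2) * concavityForm ν x) (Set.Ioi 0) := by
    refine monotoneOn_of_deriv_nonneg (convex_Ioi 0) (fun x hx =>
      (hasDerivAt_rpow_mul_concavityForm hν0 hx).continuousAt.continuousWithinAt)
      (fun x hx => ?_) fun x hx => ?_ <;> rw [interior_Ioi, Set.mem_Ioi] at hx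
    · exact (hasDerivAt_rpow_mul_concavityForm hν0 hx).differentiableAt.differentiableWithinAt
    · rw [(hasDerivAt_rpow_mul_concavityForm hν0 hx).deriv]
      have h0 := besselSeries_pos hν0 hx.le
      have h1 := besselSeries_pos (by linarith : 0 < ν + 1) hx.le
      have h2 : 0 ≤ 2 * ν - 3 := by linarith
      have h3 : 0 ≤ 2 * ν - 1 := by linarith
      unfold criticalForm
      positivity
  have hpos : 0 < concavityForm ν 0 := by
    have h0 := besselSeries_pos hν0 le_rfl
    have h3 : 0 < 2 * ν - 1 := by linarith
    simp only [concavityForm]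
    simp
    positivity
  -- The weight vanishes at 0 when $\nu>3/2$, so the comparison starts from a small $x>0$ where $N$
  -- is still positive.
  have hev := (hasDerivAt_concavityForm hν0 0).continuousAt.eventually (lt_mem_nhds hpos)
  obtain ⟨x, ⟨hx, hx0⟩, hxy⟩ := (((hev.filter_mono nhdsWithin_le_nhds).and
    (self_mem_nhdsWithin (s := Set.Ioi (0 : ℝ)))).and (Ioc_mem_nhdsGT hy)).exists
  have h := hmono hx0 hy hxy.2
  have : 0 < y ^ (ν - 3 / 2) := Real.rpow_pos_of_pos hy _
  have : 0 < x ^ (ν - 3 / 2) := Real.rpow_pos_of_pos hx0 _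
  have h' : 0 < y ^ (ν - 3 / 2) * concavityForm ν y := lt_of_lt_of_le (by positivity) h
  exact (pos_of_mul_pos_right h' (by positivity)).le

theorem concavityForm_eq_of_criticalForm_eq_zero {ν y : ℝ} (h : criticalForm ν y = 0) :
    concavityForm ν y = besselSeries ν y ^ 2 * (5 - 2 * ν - 4 * y) := by
  unfold criticalForm at h
  unfold concavityForm
  linear_combination (2 * y * besselSeries (ν + 1) y + 2 * besselSeries ν y) * h

/-- The hypothesis places the zero $c$ of $E$ in $(0,(5-2\nu)/4]$, so $N(c)\ge 0$; the weighted form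
decreases before $c$ and increases after it. -/
theorem concavityForm_nonneg_of_criticalForm_nonneg {ν : ℝ} (hν : ν ∈ Set.Ioo (1 / 2 : ℝ) (3 / 2))
    (h : 0 ≤ criticalForm ν ((5 - 2 * ν) / 4)) {y : ℝ} (hy : 0 < y) : 0 ≤ concavityForm ν y := by
  obtain ⟨hν1, hν2⟩ := hν
  have hν0 : 0 < ν := by linarith
  have hE0 : criticalForm ν 0 < 0 := by
    have h0 := besselSeries_pos hν0 le_rfl
    simp only [criticalForm]
    nlinarith
  obtain ⟨c, ⟨hc0, hc⟩, hcE⟩ := intermediate_value_Icc (by linarith : 0 ≤ (5 - 2 * ν) / 4)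
    (continuous_criticalForm hν0).continuousOn ⟨hE0.le, h⟩
  have hcpos : 0 < c := hc0.lt_of_ne (by rintro rfl; exact hE0.ne hcE)
  have hmono := strictMonoOn_criticalForm hν1
  have hd {x : ℝ} (hx : 0 < x) := hasDerivAt_rpow_mul_concavityForm hν0 hx
  have hcN : 0 ≤ concavityForm ν c := by
    rw [concavityForm_eq_of_criticalForm_eq_zero hcE]
    have : 0 ≤ 5 - 2 * ν - 4 * c := by linarith
    positivity
  have hm : 0 < 2 * ν - 1 := by linarith
  have key : c ^ (ν - 3 / 2) * concavityForm ν c ≤ y ^ (ν - 3 / 2) * concavityForm ν y := by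
    rcases le_total c y with hcy | hyc
    · refine monotoneOn_of_deriv_nonneg (f := fun x => x ^ (ν - 3 / 2) * concavityForm ν x)
        (convex_Ici c) (fun x hx =>
        (hd (hcpos.trans_le hx)).continuousAt.continuousWithinAt)
        (fun x hx => ?_) (fun x hx => ?_) Set.self_mem_Ici hcy hcy <;>
        rw [interior_Ici, Set.mem_Ioi] at hx
      · exact (hd (hcpos.trans hx)).differentiableAt.differentiableWithinAt
      · have hx0 := hcpos.trans hx
        have h0 := besselSeries_pos hν0 hx0.le
        have hE := hmono hc0 hx0.le hx
        rw [hcE] at hE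
        rw [(hd hx0).deriv]
        positivity
    · refine antitoneOn_of_deriv_nonpos (f := fun x => x ^ (ν - 3 / 2) * concavityForm ν x)
        (convex_Icc y c) (fun x hx =>
        (hd (hy.trans_le hx.1)).continuousAt.continuousWithinAt)
        (fun x hx => ?_) (fun x hx => ?_) (Set.left_mem_Icc.2 hyc) (Set.right_mem_Icc.2 hyc) hyc <;>
        rw [interior_Icc, Set.mem_Ioo] at hx
      · exact (hd (hy.trans hx.1)).differentiableAt.differentiableWithinAt
      · have hx0 := hy.trans hx.1
        have h0 := besselSeries_pos hν0 hx0.le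
        have hE := hmono hx0.le hc0 hx.2
        rw [hcE] at hE
        rw [(hd hx0).deriv]
        exact mul_nonpos_of_nonneg_of_nonpos (by positivity) hE.le
  have hyp : 0 < y ^ (ν - 3 / 2) := Real.rpow_pos_of_pos hy _
  have hcp : 0 < c ^ (ν - 3 / 2) := Real.rpow_pos_of_pos hcpos _
  exact nonneg_of_mul_nonneg_right (le_trans (by positivity) key) hyp

/-- Modulo $E$ the form $N$ is $S_\nu^2(5-2\nu-4y)$; this remainder vanishes at the chosen point,
leaving $E$ times a positive factor. -/
theorem concavityForm_neg_of_criticalForm_neg {ν : ℝ} (hν : ν ∈ Set.Ioo (1 / 2 : ℝ) (3 / 2))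
    (h : criticalForm ν ((5 - 2 * ν) / 4) < 0) : concavityForm ν ((5 - 2 * ν) / 4) < 0 := by
  obtain ⟨hν1, hν2⟩ := hν
  have h0 := besselSeries_pos (by linarith : 0 < ν) (by linarith : 0 ≤ (5 - 2 * ν) / 4)
  have h1 := besselSeries_pos (by linarith : 0 < ν + 1) (by linarith : 0 ≤ (5 - 2 * ν) / 4)
  have he : concavityForm ν ((5 - 2 * ν) / 4) = criticalForm ν ((5 - 2 * ν) / 4) *
      (2 * ((5 - 2 * ν) / 4) * besselSeries (ν + 1) ((5 - 2 * ν) / 4) +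
        2 * besselSeries ν ((5 - 2 * ν) / 4)) := by
    unfold concavityForm criticalForm
    ring
  have h5 : 0 < 5 - 2 * ν := by linarith
  rw [he]
  exact mul_neg_of_neg_of_pos h (by positivity)

theorem exists_concavityForm_neg {ν : ℝ} (hν0 : 0 < ν) (hν : ν ≤ 1 / 2) :
    ∃ y, 0 < y ∧ concavityForm ν y < 0 := by
  have hy : 0 < ν ^ 2 / 2 := by positivity
  -- Since $\nu S_{\nu+1}\le S_\nu$, at $y=\nu^2/2$ the term $4y^2S_{\nu+1}^2$ is at most
  -- $\nu^2S_\nu^2$, half of the subtracted $4yS_\nu^2$.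
  refine ⟨ν ^ 2 / 2, hy, ?_⟩
  have h0 := besselSeries_pos hν0 hy.le
  have h1 := besselSeries_pos (by linarith : 0 < ν + 1) hy.le
  have h2 := besselSeries_pos (by linarith : 0 < ν + 1 + 1) hy.le
  have hle : ν * besselSeries (ν + 1) (ν ^ 2 / 2) ≤ besselSeries ν (ν ^ 2 / 2) := by
    rw [besselSeries_recurrence hν0 (ν ^ 2 / 2)]
    have : 0 < ν ^ 2 / 2 * besselSeries (ν + 1 + 1) (ν ^ 2 / 2) := by positivity
    linarith
  have hsq := pow_le_pow_left₀ (by positivity) hle 2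
  have hA : 0 < 2 * (ν ^ 2 / 2) * besselSeries (ν + 1) (ν ^ 2 / 2) * besselSeries ν (ν ^ 2 / 2) +
    besselSeries ν (ν ^ 2 / 2) ^ 2 := by positivity
  have hB : 0 < ν ^ 2 * besselSeries ν (ν ^ 2 / 2) ^ 2 := by positivity
  have hC : ν ^ 2 * (ν * besselSeries (ν + 1) (ν ^ 2 / 2)) ^ 2 ≤
    ν ^ 2 * besselSeries ν (ν ^ 2 / 2) ^ 2 := by gcongr
  unfold concavityForm
  nlinarith [mul_nonneg (by linarith : 0 ≤ 1 - 2 * ν) hA.le]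

/-! ### Log-concavity of the integrand and concavity of the kernel -/

theorem logConcaveOn_iff_concaveOn_log {s : Set ℝ} {f : ℝ → ℝ} (hf : ∀ x ∈ s, 0 < f x) :
    LogConcaveOn s f ↔ ConcaveOn ℝ s fun x => Real.log (f x) := by
  rw [concaveOn_iff_forall_pos, LogConcaveOn]
  refine and_congr_right fun hs => ?_
  rw [and_iff_right fun x hx => (hf x hx).le]
  have key {x y p q : ℝ} (hx : x ∈ s) (hy : y ∈ s) (hp : 0 < p) (hq : 0 < q) (hpq : p + q = 1) :
      f x ^ p * f y ^ q ≤ f (p * x + q * y) ↔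
        p * Real.log (f x) + q * Real.log (f y) ≤ Real.log (f (p * x + q * y)) := by
    rw [Real.le_log_iff_exp_le (hf _ (by simpa using hs hx hy hp.le hq.le hpq)), Real.exp_add,
      Real.rpow_def_of_pos (hf x hx), Real.rpow_def_of_pos (hf y hy), mul_comm (Real.log (f x)),
      mul_comm (Real.log (f y))]
  constructor
  · intro h x hx y hy p q hp hq hpq
    simpa using (key hx hy hp hq hpq).1 (h x hx y hy p q hp hq hpq)
  · intro h x hx y hy p q hp hq hpq
    exact (key hx hy hp hq hpq).2 (by simpa using h hx hy hp hq hpq)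

/-- The logarithm of `u ^ (2ν-1) S_ν(u²/4)`. -/
noncomputable def logKernel (ν u : ℝ) : ℝ :=
  (2 * ν - 1) * Real.log u + Real.log (besselSeries ν ((u / 2) ^ 2))

theorem hasDerivAt_logKernel {ν u : ℝ} (hν : 0 < ν) (hu : 0 < u) :
    HasDerivAt (logKernel ν) ((2 * ν - 1) / u +
      u / 2 * (besselSeries (ν + 1) ((u / 2) ^ 2) / besselSeries ν ((u / 2) ^ 2))) u := by
  have h0 := besselSeries_pos hν (sq_nonneg (u / 2))
  have hid := ((hasDerivAt_id' u).div_const 2).pow 2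
  have hs := (hasDerivAt_besselSeries hν ((u / 2) ^ 2)).comp u hid
  refine HasDerivAt.congr_deriv (((Real.hasDerivAt_log hu.ne').const_mul (2 * ν - 1)).add
    (hs.log h0.ne')) ?_
  simp
  field_simp

theorem hasDerivAt_deriv_logKernel {ν u : ℝ} (hν : 0 < ν) (hu : 0 < u) :
    HasDerivAt (fun v => (2 * ν - 1) / v +
      v / 2 * (besselSeries (ν + 1) ((v / 2) ^ 2) / besselSeries ν ((v / 2) ^ 2)))
      (-concavityForm ν ((u / 2) ^ 2) / (u * besselSeries ν ((u / 2) ^ 2)) ^ 2) u := by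
  have h0 := besselSeries_pos hν (sq_nonneg (u / 2))
  have hid := ((hasDerivAt_id' u).div_const 2).pow 2
  have hs := (hasDerivAt_besselSeries hν ((u / 2) ^ 2)).comp u hid
  have hs1 := (hasDerivAt_besselSeries (by linarith : 0 < ν + 1) ((u / 2) ^ 2)).comp u hid
  refine HasDerivAt.congr_deriv (((hasDerivAt_inv hu.ne').const_mul (2 * ν - 1)).add
    (((hasDerivAt_id' u).div_const 2).mul (hs1.div hs h0.ne'))) ?_
  have hr := besselSeries_recurrence hν ((u / 2) ^ 2)
  simp only [Function.comp_apply, concavityForm]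
  simp
  set s0 := besselSeries ν ((u / 2) ^ 2)
  set s1 := besselSeries (ν + 1) ((u / 2) ^ 2)
  set s2 := besselSeries (ν + 1 + 1) ((u / 2) ^ 2)
  field_simp
  linear_combination (-16 * u ^ 2 * s0) * hr

theorem concaveOn_logKernel_iff {ν : ℝ} (hν : 0 < ν) :
    ConcaveOn ℝ (Set.Ioi 0) (logKernel ν) ↔ ∀ y, 0 < y → 0 ≤ concavityForm ν y := by
  constructor
  · intro h y hy
    have hu : 0 < 2 * Real.sqrt y := by positivity
    have hanti := h.antitoneOn_deriv fun u hu => (hasDerivAt_logKernel hν hu).differentiableAt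
    have h2 := (hanti.congr fun u hu =>
      (hasDerivAt_logKernel hν hu).deriv).derivWithin_nonpos (x := 2 * Real.sqrt y)
    rw [derivWithin_of_isOpen isOpen_Ioi hu, (hasDerivAt_deriv_logKernel hν hu).deriv,
      mul_div_cancel_left₀ _ two_ne_zero, Real.sq_sqrt hy.le] at h2
    have h0 := besselSeries_pos hν hy.le
    by_contra! hlt
    have : 0 < -concavityForm ν y / (2 * Real.sqrt y * besselSeries ν y) ^ 2 :=
      div_pos (by linarith) (by positivity)
    linarith
  · intro h
    refine concaveOn_of_hasDerivWithinAt2_nonpos (convex_Ioi 0)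
      (fun u hu => (hasDerivAt_logKernel hν hu).continuousAt.continuousWithinAt)
      (fun u hu => (hasDerivAt_logKernel hν (interior_subset hu)).hasDerivWithinAt)
      (fun u hu => (hasDerivAt_deriv_logKernel hν (interior_subset hu)).hasDerivWithinAt)
      fun u hu => ?_
    have hu' : 0 < u := interior_subset hu
    exact div_nonpos_of_nonpos_of_nonneg (by linarith [h ((u / 2) ^ 2) (by positivity)])
      (by positivity)

theorem marcumIntegrand_eq {ν a t : ℝ} (ha : 0 < a) (ht : 0 < t) :
    marcumIntegrand ν a t = t ^ ν * (t / 2) ^ (ν - 1) * Real.exp (-((t ^ 2 + a ^ 2) / 2)) *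
      besselSeries ν ((a * t / 2) ^ 2) := by
  rw [marcumIntegrand_of_pos ha ht, besselSeries]
  simp only [pow_mul]

theorem marcumIntegrand_pos {ν a t : ℝ} (hν : 0 < ν) (ha : 0 ≤ a) (ht : 0 < t) :
    0 < marcumIntegrand ν a t := by
  rcases ha.eq_or_lt with rfl | ha
  · have := Real.Gamma_pos_of_pos hν
    rw [marcumIntegrand, if_pos rfl]
    positivity
  · have := besselSeries_pos hν (sq_nonneg (a * t / 2))
    rw [marcumIntegrand_eq ha ht]
    positivity

theorem log_marcumIntegrand {ν a t : ℝ} (hν : 0 < ν) (ha : 0 < a) (ht : 0 < t) :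
    Real.log (marcumIntegrand ν a t) = logKernel ν (a * t) - t ^ 2 / 2 -
      ((ν - 1) * Real.log 2 + a ^ 2 / 2 + (2 * ν - 1) * Real.log a) := by
  have := besselSeries_pos hν (sq_nonneg (a * t / 2))
  rw [marcumIntegrand_eq ha ht, Real.log_mul (by positivity) (by positivity),
    Real.log_mul (by positivity) (by positivity), Real.log_mul (by positivity) (by positivity),
    Real.log_exp, Real.log_rpow ht, Real.log_rpow (by positivity),
    Real.log_div ht.ne' two_ne_zero, logKernel, Real.log_mul ha.ne' ht.ne']
  ring

theorem log_marcumIntegrand_zero {ν t : ℝ} (hν : 0 < ν) (ht : 0 < t) :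
    Real.log (marcumIntegrand ν 0 t) = (2 * ν - 1) * Real.log t - t ^ 2 / 2 -
      Real.log (2 ^ (ν - 1) * Real.Gamma ν) := by
  have := Real.Gamma_pos_of_pos hν
  rw [marcumIntegrand, if_pos rfl, Real.log_div (by positivity) (by positivity),
    Real.log_mul (by positivity) (by positivity), Real.log_exp, Real.log_rpow ht]
  ring

theorem half_sq_convex {x y p q : ℝ} (hp : 0 < p) (hq : 0 < q) (hpq : p + q = 1) :
    (p * x + q * y) ^ 2 / 2 ≤ p * (x ^ 2 / 2) + q * (y ^ 2 / 2) := by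
  obtain rfl : q = 1 - p := by linarith
  nlinarith [mul_nonneg (mul_pos hp hq).le (sq_nonneg (x - y))]

theorem marcumIntegrand_logConcave_of_concaveOn {ν : ℝ} (hν : 1 / 2 ≤ ν)
    (h : ConcaveOn ℝ (Set.Ioi 0) (logKernel ν)) {a : ℝ} (ha : 0 ≤ a) :
    LogConcaveOn (Set.Ioi 0) (fun t => marcumIntegrand ν a t) := by
  have hν0 : 0 < ν := by linarith
  rw [logConcaveOn_iff_concaveOn_log (s := Set.Ioi 0) (f := fun t => marcumIntegrand ν a t)
    fun t ht => marcumIntegrand_pos hν0 ha ht,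
    concaveOn_iff_forall_pos]
  refine ⟨convex_Ioi 0, fun x hx y hy p q hp hq hpq => ?_⟩
  rw [Set.mem_Ioi] at hx hy
  simp only [smul_eq_mul]
  have hxy : 0 < p * x + q * y := by positivity
  have hsq := half_sq_convex (x := x) (y := y) hp hq hpq
  rcases ha.eq_or_lt with rfl | ha
  · rw [log_marcumIntegrand_zero hν0 hx, log_marcumIntegrand_zero hν0 hy,
      log_marcumIntegrand_zero hν0 hxy]
    have hl := strictConcaveOn_log_Ioi.concaveOn.2 hx hy hp.le hq.le hpq
    simp only [smul_eq_mul] at hl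
    have := mul_le_mul_of_nonneg_left hl (by linarith : 0 ≤ 2 * ν - 1)
    generalize Real.log (2 ^ (ν - 1) * Real.Gamma ν) = C
    have hC : C = p * C + q * C := by rw [← add_mul, hpq, one_mul]
    linarith
  · rw [log_marcumIntegrand hν0 ha hx, log_marcumIntegrand hν0 ha hy,
      log_marcumIntegrand hν0 ha hxy]
    have hk := h.2 (mul_pos ha hx) (mul_pos ha hy) hp.le hq.le hpq
    simp only [smul_eq_mul] at hk
    rw [show p * (a * x) + q * (a * y) = a * (p * x + q * y) by ring] at hk
    generalize (ν - 1) * Real.log 2 + a ^ 2 / 2 + (2 * ν - 1) * Real.log a = C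
    have hC : C = p * C + q * C := by rw [← add_mul, hpq, one_mul]
    linarith

/-- Letting `a → ∞` removes the Gaussian factor. -/
theorem concaveOn_logKernel_of_logConcave {ν : ℝ} (hν0 : 0 < ν)
    (h : ∀ a : ℝ, 0 ≤ a → LogConcaveOn (Set.Ioi 0) (fun t => marcumIntegrand ν a t)) :
    ConcaveOn ℝ (Set.Ioi 0) (logKernel ν) := by
  rw [concaveOn_iff_forall_pos]
  refine ⟨convex_Ioi 0, fun x hx y hy p q hp hq hpq => ?_⟩
  rw [Set.mem_Ioi] at hx hy
  simp only [smul_eq_mul]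
  have hxy : 0 < p * x + q * y := by positivity
  have hlim : Filter.Tendsto (fun a : ℝ => logKernel ν (p * x + q * y) +
      (p * (x ^ 2 / 2) + q * (y ^ 2 / 2)) / a ^ 2) Filter.atTop
      (nhds (logKernel ν (p * x + q * y) + 0)) :=
    tendsto_const_nhds.add
      (tendsto_const_nhds.div_atTop (Filter.tendsto_pow_atTop two_ne_zero))
  rw [add_zero] at hlim
  refine ge_of_tendsto hlim ?_
  filter_upwards [Filter.eventually_gt_atTop 0] with a ha
  -- At the points $x/a$ and $y/a$ the kernel is evaluated at $x$ and $y$, while the Gaussian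
  -- contributes $O(a^{-2})$.
  have hc := ((logConcaveOn_iff_concaveOn_log fun t ht =>
    marcumIntegrand_pos hν0 ha.le ht).1 (h a ha.le)).2 (div_pos hx ha) (div_pos hy ha)
    hp.le hq.le hpq
  simp only [smul_eq_mul] at hc
  rw [show p * (x / a) + q * (y / a) = (p * x + q * y) / a by ring,
    log_marcumIntegrand hν0 ha (div_pos hx ha), log_marcumIntegrand hν0 ha (div_pos hy ha),
    log_marcumIntegrand hν0 ha (div_pos hxy ha), mul_div_cancel₀ _ ha.ne',
    mul_div_cancel₀ _ ha.ne', mul_div_cancel₀ _ ha.ne'] at hc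
  revert hc
  generalize (ν - 1) * Real.log 2 + a ^ 2 / 2 + (2 * ν - 1) * Real.log a = C
  intro hc
  have hC : C = p * C + q * C := by rw [← add_mul, hpq, one_mul]
  have hsq : 0 ≤ ((p * x + q * y) / a) ^ 2 / 2 := by positivity
  have he : (p * (x ^ 2 / 2) + q * (y ^ 2 / 2)) / a ^ 2 =
      p * ((x / a) ^ 2 / 2) + q * ((y / a) ^ 2 / 2) := by
    field_simp
  rw [he]
  linarith

theorem marcumIntegrand_logConcave_iff {ν : ℝ} (hν : 0 < ν) :
    (∀ a : ℝ, 0 ≤ a → LogConcaveOn (Set.Ioi 0) (fun t => marcumIntegrand ν a t)) ↔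
      ∀ y, 0 < y → 0 ≤ concavityForm ν y := by
  rw [← concaveOn_logKernel_iff hν]
  refine ⟨concaveOn_logKernel_of_logConcave hν, fun h a ha =>
    marcumIntegrand_logConcave_of_concaveOn ?_ h ha⟩
  -- The case $a=0$ needs $2\nu-1\ge 0$; below $1/2$ the kernel is not concave.
  by_contra! hlt
  obtain ⟨y, hy, hneg⟩ := exists_concavityForm_neg hν hlt.le
  linarith [(concaveOn_logKernel_iff hν).1 h y hy]

/-! ### The continued fraction and its Lipschitz tail -/

/-- The ratio `z I_{ν+j}(z) / I_{ν+j-1}(z)` at `z² = 5 - 2ν`. -/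
noncomputable def ratioAt (j : ℕ) (ν : ℝ) : ℝ := besselRatio (ν + j) ((5 - 2 * ν) / 4)

theorem ratioAt_pos {ν : ℝ} (hν : ν ∈ Set.Ioo (1 / 2 : ℝ) (3 / 2)) (j : ℕ) : 0 < ratioAt j ν :=
  besselRatio_pos (by have := hν.1; positivity) (by linarith [hν.2])

theorem ratioAt_recurrence {ν : ℝ} (hν : ν ∈ Set.Ioo (1 / 2 : ℝ) (3 / 2)) (j : ℕ) :
    ratioAt j ν * (2 * ν + 2 * j + ratioAt (j + 1) ν) = 5 - 2 * ν := by
  have h := besselRatio_recurrence (ν := ν + j) (y := (5 - 2 * ν) / 4)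
    (by have := hν.1; positivity) (by linarith [hν.2])
  simp only [ratioAt]
  push_cast
  rw [← add_assoc]
  linarith

theorem ratioAt_lt {ν : ℝ} (hν : ν ∈ Set.Ioo (1 / 2 : ℝ) (3 / 2)) (j : ℕ) :
    ratioAt j ν * (2 * ν + 2 * j) < 5 - 2 * ν := by
  nlinarith [ratioAt_recurrence hν j, mul_pos (ratioAt_pos hν j) (ratioAt_pos hν (j + 1))]

theorem ratioAt_le_four_fifths {ν : ℝ} (hν : ν ∈ Set.Ioo (1 / 2 : ℝ) (3 / 2)) {j : ℕ}
    (hj : 2 ≤ j) : ratioAt j ν ≤ 4 / 5 := by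
  have hj' : (2 : ℝ) ≤ j := by exact_mod_cast hj
  nlinarith [ratioAt_lt hν j, ratioAt_pos hν j, hν.1]

/-- With $d=|\mu-\nu|$, the recurrence gives $5|\Delta r_j|\le 2d+\frac45(2d+|\Delta r_{j+1}|)$. As
$\frac{18}5+\frac45\le 5$, the coefficient of $d$ stays at most 1, and the error shrinks by more
than a factor 4. The induction covers all $j\ge 2$ at once because each step raises $j$. -/
theorem abs_ratioAt_sub_le_aux {μ ν : ℝ} (hμ : μ ∈ Set.Ioo (1 / 2 : ℝ) (3 / 2))
    (hν : ν ∈ Set.Ioo (1 / 2 : ℝ) (3 / 2)) (n : ℕ) :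
    ∀ j : ℕ, 2 ≤ j → |ratioAt j μ - ratioAt j ν| ≤ |μ - ν| + (1 / 4) ^ n := by
  induction n with
  | zero =>
    intro j hj
    have h1 := ratioAt_pos hμ j
    have h2 := ratioAt_pos hν j
    have h3 := ratioAt_le_four_fifths hμ hj
    have h4 := ratioAt_le_four_fifths hν hj
    rw [pow_zero, abs_le]
    constructor <;> linarith [abs_nonneg (μ - ν)]
  | succ n ih =>
    intro j hj
    have hj' : (2 : ℝ) ≤ j := by exact_mod_cast hj
    have hd := ih (j + 1) (by omega)
    have hw := ratioAt_le_four_fifths hν hj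
    have hw0 := ratioAt_pos hν j
    set A := 2 * μ + 2 * j + ratioAt (j + 1) μ with hA
    have hA5 : 5 ≤ A := by linarith [hμ.1, ratioAt_pos hμ (j + 1)]
    have he : (ratioAt j μ - ratioAt j ν) * A =
        (-2 * (μ - ν)) + ratioAt j ν * (-2 * (μ - ν) - (ratioAt (j + 1) μ - ratioAt (j + 1) ν)) := by
      linear_combination ratioAt_recurrence hμ j - ratioAt_recurrence hν j
    have hb : |ratioAt j μ - ratioAt j ν| * A ≤
        2 * |μ - ν| + 4 / 5 * (2 * |μ - ν| + |ratioAt (j + 1) μ - ratioAt (j + 1) ν|) := by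
      rw [← abs_of_pos (by linarith : 0 < A), ← abs_mul, he]
      refine (abs_add_le _ _).trans ?_
      rw [abs_mul (ratioAt j ν), abs_of_pos hw0, abs_mul (-2 : ℝ)]
      have h2 : |-2 * (μ - ν) - (ratioAt (j + 1) μ - ratioAt (j + 1) ν)| ≤
          2 * |μ - ν| + |ratioAt (j + 1) μ - ratioAt (j + 1) ν| := by
        refine (abs_sub _ _).trans ?_
        rw [abs_mul]
        norm_num
      have h3 : |(-2 : ℝ)| = 2 := by norm_num
      rw [h3]
      gcongr
    have h5 := mul_le_mul_of_nonneg_left hA5 (abs_nonneg (ratioAt j μ - ratioAt j ν))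
    have hp : (0 : ℝ) < (1 / 4) ^ n := by positivity
    rw [pow_succ]
    linarith [abs_nonneg (μ - ν)]

theorem abs_ratioAt_two_sub_le {μ ν : ℝ} (hμ : μ ∈ Set.Ioo (1 / 2 : ℝ) (3 / 2))
    (hν : ν ∈ Set.Ioo (1 / 2 : ℝ) (3 / 2)) : |ratioAt 2 μ - ratioAt 2 ν| ≤ |μ - ν| := by
  have hlim : Filter.Tendsto (fun n : ℕ => |μ - ν| + (1 / 4 : ℝ) ^ n) Filter.atTop
      (nhds (|μ - ν| + 0)) :=
    tendsto_const_nhds.add (tendsto_pow_atTop_nhds_zero_of_lt_one (by norm_num) (by norm_num))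
  rw [add_zero] at hlim
  exact ge_of_tendsto' hlim fun n => abs_ratioAt_sub_le_aux hμ hν n 2 le_rfl

/-! ### Locating the root -/

/-- The defect, after two steps of the continued fraction, of the equation
`I_ν(z) / I_{ν-1}(z) = (3 - 2ν) / z` at `z² = 5 - 2ν`. -/
noncomputable def defect (ν : ℝ) : ℝ :=
  ratioAt 2 ν - ((5 - 2 * ν) * (3 - 2 * ν) / (4 * ν ^ 2 - 8 * ν + 5) - 2 * ν - 2)

theorem defect_denom_pos (ν : ℝ) : 0 < 4 * ν ^ 2 - 8 * ν + 5 := by nlinarith [sq_nonneg (ν - 1)]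

/-- $E$ has the sign of $r_0-(3-2\nu)$. Each step of the continued fraction reverses order, so two
steps preserve that sign. -/
theorem exists_criticalForm_mul_eq_defect {ν : ℝ} (hν : ν ∈ Set.Ioo (1 / 2 : ℝ) (3 / 2)) :
    ∃ P, 0 < P ∧ criticalForm ν ((5 - 2 * ν) / 4) * P = defect ν := by
  have h1 := ratioAt_pos hν 1
  have h2 := ratioAt_pos hν 2
  have r0 := ratioAt_recurrence hν 0
  have r1 := ratioAt_recurrence hν 1
  have hν0 : 0 < ν := by linarith [hν.1]
  have hs := besselSeries_pos hν0 (by linarith [hν.2] : 0 ≤ (5 - 2 * ν) / 4)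
  have hq := defect_denom_pos ν
  have hE : criticalForm ν ((5 - 2 * ν) / 4) =
      besselSeries ν ((5 - 2 * ν) / 4) * (ratioAt 0 ν - (3 - 2 * ν)) := by
    simp only [ratioAt, besselRatio, criticalForm, Nat.cast_zero, add_zero]
    field_simp
    ring
  refine ⟨(2 * ν + ratioAt 1 ν) * (2 * ν + 2 + ratioAt 2 ν) /
    ((4 * ν ^ 2 - 8 * ν + 5) * besselSeries ν ((5 - 2 * ν) / 4)), by positivity, ?_⟩
  rw [hE, defect]
  norm_num at r0 r1
  obtain ⟨q, hqe⟩ : ∃ q, q = 4 * ν ^ 2 - 8 * ν + 5 := ⟨_, rfl⟩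
  rw [← hqe] at hq ⊢
  field_simp
  linear_combination (2 * ν + 2 + ratioAt 2 ν) * r0 - (3 - 2 * ν) * r1 -
    (2 * ν + 2 + ratioAt 2 ν) * hqe

/-- The rational quotient is nonincreasing on $[3/4,9/10]$, though not near $1/2$; the term $2\nu$
contributes slope 2 and the tail costs at most 1. -/
theorem defect_sub_ge {μ ν : ℝ} (hμ : 3 / 4 ≤ μ) (hμν : μ ≤ ν) (hν : ν ≤ 9 / 10) :
    ν - μ ≤ defect ν - defect μ := by
  have hl := abs_ratioAt_two_sub_le (μ := μ) (ν := ν) ⟨by linarith, by linarith⟩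
    ⟨by linarith, by linarith⟩
  rw [abs_sub_comm μ, abs_of_nonneg (by linarith : 0 ≤ ν - μ)] at hl
  have hl' := (abs_le.1 hl).2
  have hR : (5 - 2 * ν) * (3 - 2 * ν) / (4 * ν ^ 2 - 8 * ν + 5) ≤
      (5 - 2 * μ) * (3 - 2 * μ) / (4 * μ ^ 2 - 8 * μ + 5) := by
    rw [div_le_div_iff₀ (defect_denom_pos ν) (defect_denom_pos μ)]
    have hfac : (5 - 2 * μ) * (3 - 2 * μ) * (4 * ν ^ 2 - 8 * ν + 5) -
        (5 - 2 * ν) * (3 - 2 * ν) * (4 * μ ^ 2 - 8 * μ + 5) =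
        (ν - μ) * (40 * (μ + ν) - 32 * μ * ν - 40) := by ring
    have : 0 ≤ 40 * (μ + ν) - 32 * μ * ν - 40 := by
      nlinarith [mul_nonneg (by linarith : 0 ≤ μ - 3 / 4) (by linarith : 0 ≤ 9 / 10 - ν)]
    nlinarith [mul_nonneg (by linarith : 0 ≤ ν - μ) this]
  unfold defect
  linarith

/-- Dropping $r_3$ bounds the tail by $(5-2\nu)/(2\nu+4)$, which suffices away from the root. -/
theorem defect_neg_of_le {ν : ℝ} (h1 : 1 / 2 < ν) (h2 : ν ≤ 3 / 4) : defect ν < 0 := by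
  have hlt := ratioAt_lt (ν := ν) ⟨h1, by linarith⟩ 2
  push_cast at hlt
  have hq := defect_denom_pos ν
  have h0 : ratioAt 2 ν < (5 - 2 * ν) / (2 * ν + 2 * 2) := by
    rwa [lt_div_iff₀ (by linarith)]
  have h3 : (5 - 2 * ν) / (2 * ν + 2 * 2) ≤
      (5 - 2 * ν) * (3 - 2 * ν) / (4 * ν ^ 2 - 8 * ν + 5) - 2 * ν - 2 := by
    rw [sub_sub, le_sub_iff_add_le, div_add' _ _ _ (by linarith), div_le_div_iff₀ (by linarith) hq]
    have ha : 0 ≤ ν - 1 / 2 := by linarith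
    have hb : 0 ≤ 3 / 4 - ν := by linarith
    nlinarith [mul_nonneg ha hb, mul_nonneg (mul_nonneg ha hb) ha, mul_nonneg (mul_nonneg ha hb) hb,
      mul_nonneg (mul_nonneg ha ha) (mul_nonneg ha hb), mul_nonneg (mul_nonneg ha hb) (mul_nonneg ha hb)]
  unfold defect
  linarith

theorem defect_pos_of_ge {ν : ℝ} (h1 : 9 / 10 ≤ ν) (h2 : ν < 3 / 2) : 0 < defect ν := by
  have hpos := ratioAt_pos (ν := ν) ⟨by linarith, h2⟩ 2
  have h3 : (5 - 2 * ν) * (3 - 2 * ν) / (4 * ν ^ 2 - 8 * ν + 5) ≤ 2 * ν + 2 := by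
    rw [div_le_iff₀ (defect_denom_pos ν)]
    nlinarith [mul_nonneg (by linarith : 0 ≤ ν - 9 / 10) (sq_nonneg ν),
      mul_nonneg (by linarith : 0 ≤ ν - 9 / 10) (sq_nonneg (ν - 1)), sq_nonneg (ν - 1)]
  unfold defect
  linarith

theorem ratioAt_le_div {ν : ℝ} (hν : ν ∈ Set.Ioo (1 / 2 : ℝ) (3 / 2)) {j : ℕ} {l : ℝ}
    (hl0 : 0 ≤ l) (hl : l ≤ ratioAt (j + 1) ν) :
    ratioAt j ν ≤ (5 - 2 * ν) / (2 * ν + 2 * j + l) := by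
  have := hν.1
  rw [le_div_iff₀ (by positivity), ← ratioAt_recurrence hν j]
  have := ratioAt_pos hν j
  gcongr

theorem div_le_ratioAt {ν : ℝ} (hν : ν ∈ Set.Ioo (1 / 2 : ℝ) (3 / 2)) {j : ℕ} {u : ℝ}
    (hu : ratioAt (j + 1) ν ≤ u) :
    (5 - 2 * ν) / (2 * ν + 2 * j + u) ≤ ratioAt j ν := by
  have := hν.1
  have h0 := ratioAt_pos hν (j + 1)
  have h1 := ratioAt_pos hν j
  have : 0 < u := h0.trans_le hu
  rw [div_le_iff₀ (by positivity), ← ratioAt_recurrence hν j]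
  gcongr

/-- Bounds alternate along the continued fraction: an upper bound on $r_2$ comes from $r_7\ge 0$. At
the other endpoint a lower bound is needed, so the truncation starts from $r_8$, of opposite parity.
-/
theorem defect_lower_endpoint_neg : defect 0.784497755 < 0 := by
  have hν : (0.784497755 : ℝ) ∈ Set.Ioo (1 / 2 : ℝ) (3 / 2) := by constructor <;> norm_num
  have h6 := ratioAt_le_div hν (j := 6) le_rfl (ratioAt_pos hν 7).le
  have h5 := div_le_ratioAt hν (j := 5) h6
  have h4 := ratioAt_le_div hν (j := 4) (by norm_num) h5
  have h3 := div_le_ratioAt hν (j := 3) h4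
  have h2 := ratioAt_le_div hν (j := 2) (by norm_num) h3
  unfold defect
  refine (sub_le_sub_right h2 _).trans_lt ?_
  norm_num

theorem defect_upper_endpoint_pos : 0 < defect 0.784497765 := by
  have hν : (0.784497765 : ℝ) ∈ Set.Ioo (1 / 2 : ℝ) (3 / 2) := by constructor <;> norm_num
  have h7 := ratioAt_le_div hν (j := 7) le_rfl (ratioAt_pos hν 8).le
  have h6 := div_le_ratioAt hν (j := 6) h7
  have h5 := ratioAt_le_div hν (j := 5) (by norm_num) h6
  have h4 := div_le_ratioAt hν (j := 4) h5
  have h3 := ratioAt_le_div hν (j := 3) (by norm_num) h4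
  have h2 := div_le_ratioAt hν (j := 2) h3
  unfold defect
  refine lt_of_lt_of_le ?_ (sub_le_sub_right h2 _)
  norm_num

theorem continuousOn_defect : ContinuousOn defect (Set.Ioo (1 / 2) (3 / 2)) := by
  have h : LipschitzOnWith 1 (ratioAt 2) (Set.Ioo (1 / 2) (3 / 2)) :=
    LipschitzOnWith.of_dist_le_mul fun μ hμ ν hν => by
      simpa [Real.dist_eq] using abs_ratioAt_two_sub_le hμ hν
  refine h.continuousOn.sub (Continuous.continuousOn ?_)
  have hq (ν : ℝ) : 4 * ν ^ 2 - 8 * ν + 5 ≠ 0 := (defect_denom_pos ν).ne'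
  fun_prop (disch := exact hq _)

theorem criticalForm_nonneg_iff {ν : ℝ} (hν : ν ∈ Set.Ioo (1 / 2 : ℝ) (3 / 2)) :
    0 ≤ criticalForm ν ((5 - 2 * ν) / 4) ↔ 0 ≤ defect ν := by
  obtain ⟨P, hP, h⟩ := exists_criticalForm_mul_eq_defect hν
  rw [← h, mul_nonneg_iff_of_pos_right hP]

theorem besselI_ratio_eq_iff {ν : ℝ} (hν : ν ∈ Set.Ioo (1 / 2 : ℝ) (3 / 2)) :
    besselI ν (Real.sqrt (5 - 2 * ν)) / besselI (ν - 1) (Real.sqrt (5 - 2 * ν))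
      = (3 - 2 * ν) / Real.sqrt (5 - 2 * ν) ↔ defect ν = 0 := by
  obtain ⟨P, hP, h⟩ := exists_criticalForm_mul_eq_defect hν
  have h5 : 0 < 5 - 2 * ν := by linarith [hν.2]
  have hz := Real.sqrt_pos.2 h5
  have hsq := Real.sq_sqrt h5.le
  have hs := besselSeries_pos (by linarith [hν.1] : 0 < ν) (by linarith : 0 ≤ (5 - 2 * ν) / 4)
  rw [← h, mul_eq_zero, or_iff_left hP.ne', besselI_eq_rpow_mul_besselSeries _ hz,
    besselI_eq_rpow_mul_besselSeries _ hz, sub_add_cancel, div_pow, hsq, criticalForm]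
  norm_num
  have hp : (Real.sqrt (5 - 2 * ν) / 2) ^ ν =
      (Real.sqrt (5 - 2 * ν) / 2) ^ (ν - 1) * (Real.sqrt (5 - 2 * ν) / 2) := by
    rw [← Real.rpow_add_one (by positivity), sub_add_cancel]
  have hpp : 0 < (Real.sqrt (5 - 2 * ν) / 2) ^ (ν - 1) := by positivity
  rw [hp, mul_assoc, mul_div_mul_left _ _ hpp.ne', div_eq_div_iff hs.ne' hz.ne']
  constructor <;> intro heq
  · linear_combination heq - besselSeries (ν + 1) ((5 - 2 * ν) / 4) / 2 * hsq
  · linear_combination heq + besselSeries (ν + 1) ((5 - 2 * ν) / 4) / 2 * hsq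

theorem exists_defect_root :
    ∃ ν₀ : ℝ, ν₀ ∈ Set.Icc (0.784497755 : ℝ) 0.784497765 ∧
      ∀ ν ∈ Set.Ioo (1 / 2 : ℝ) (3 / 2), (defect ν = 0 ↔ ν = ν₀) ∧ (0 ≤ defect ν ↔ ν₀ ≤ ν) := by
  obtain ⟨ν₀, hmem, h0⟩ := intermediate_value_Icc (f := defect)
    (by norm_num : (0.784497755 : ℝ) ≤ 0.784497765)
    (continuousOn_defect.mono fun x hx =>
      ⟨lt_of_lt_of_le (by norm_num) hx.1, lt_of_le_of_lt hx.2 (by norm_num)⟩)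
    ⟨defect_lower_endpoint_neg.le, defect_upper_endpoint_pos.le⟩
  refine ⟨ν₀, hmem, fun ν hν => ?_⟩
  have hl : (3 / 4 : ℝ) ≤ ν₀ := le_trans (by norm_num) hmem.1
  have hr : ν₀ ≤ (9 / 10 : ℝ) := hmem.2.trans (by norm_num)
  have hneg (hlt : ν < ν₀) : defect ν < 0 := by
    rcases le_total ν (3 / 4) with h | h
    · exact defect_neg_of_le hν.1 h
    · linarith [defect_sub_ge h hlt.le hr]
  have hpos (hlt : ν₀ < ν) : 0 < defect ν := by
    rcases le_total (9 / 10) ν with h | h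
    · exact defect_pos_of_ge h hν.2
    · linarith [defect_sub_ge hl hlt.le h]
  rcases lt_trichotomy ν ν₀ with h | rfl | h
  · simp [(hneg h).ne, h.ne, (hneg h).not_ge, h.not_ge]
  · simp [h0]
  · simp [(hpos h).ne', h.ne', (hpos h).le, h.le]

theorem theorem2 :
    ∃ ν₀ : ℝ,
      (∀ ν : ℝ, ν ∈ Set.Ioo (1 / 2 : ℝ) (3 / 2) →
        (besselI ν (Real.sqrt (5 - 2 * ν)) / besselI (ν - 1) (Real.sqrt (5 - 2 * ν))
            = (3 - 2 * ν) / Real.sqrt (5 - 2 * ν) ↔ ν = ν₀)) ∧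
      ν₀ ∈ Set.Ioo (1 / 2 : ℝ) (3 / 2) ∧
      |ν₀ - 0.78449776| ≤ 5 * (10 : ℝ) ^ (-9 : ℤ) ∧
      ∀ ν : ℝ, 0 < ν →
        ((∀ a : ℝ, 0 ≤ a → LogConcaveOn (Set.Ioi 0) (fun t => marcumIntegrand ν a t)) ↔
          ν₀ ≤ ν) := by
  obtain ⟨ν₀, ⟨hl, hr⟩, h⟩ := exists_defect_root
  norm_num at hl hr
  refine ⟨ν₀, fun ν hν => (besselI_ratio_eq_iff hν).trans (h ν hν).1,
    ⟨by linarith, by linarith⟩, ?_, fun ν hν => ?_⟩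
  · rw [abs_le]
    norm_num
    constructor <;> linarith
  rw [marcumIntegrand_logConcave_iff hν]
  rcases le_or_gt ν (1 / 2) with h1 | h1
  · obtain ⟨y, hy, hneg⟩ := exists_concavityForm_neg hν h1
    exact iff_of_false (fun hall => hneg.not_ge (hall y hy)) (by linarith)
  rcases le_or_gt (3 / 2) ν with h2 | h2
  · exact iff_of_true (fun y hy => concavityForm_nonneg_of_three_halves_le h2 hy) (by linarith)
  rw [← (h ν ⟨h1, h2⟩).2, ← criticalForm_nonneg_iff ⟨h1, h2⟩]
  refine ⟨fun hall => ?_, fun hE y hy =>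
    concavityForm_nonneg_of_criticalForm_nonneg ⟨h1, h2⟩ hE hy⟩
  by_contra! hlt
  exact (concavityForm_neg_of_criticalForm_neg ⟨h1, h2⟩ hlt).not_ge
    (hall _ (by linarith))
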